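/- Let $R$ be a commutative ring with $1$. Let $(A,B,M,N,\Phi_{MN},\Psi_{NM})$ be a Morita context over $R$: $A,B$ are unital $R$-algebras, $M$ is an $(A,B)$-bimodule and $N$ a $(B,A)$-bimodule (with compatible $R$-actions), and $\Phi_{MN}:M\otimes_B N\to A$, $\Psi_{NM}:N\otimes_A M\to B$ are bimodule homomorphisms, written $m\otimes n\mapsto mn$ and $n\otimes m\mapsto nm$, such that $(mn)m'=m(nm')$ and $(nm)n'=n(mn')$ for all $m,m'\in M$, $n,n'\in N$. Assume that at least one of $M,N$ is nonzero, and that $M$ and $N$ are $2$-torsion free ($2x=0$ implies $x=0$). Let $$\mathcal G=\begin{pmatrix}A&M\\ N&B\end{pmatrix}$$ be the associated generalized matrix algebra, with the usual matrix operations, let $Z(\cdot)$ denote the centre, and let $\pi_A:\mathcal G\to A$ and $\pi_B:\mathcal G\to B$ be the projections $\begin{pmatrix}a&m\\ n&b\end{pmatrix}\mapsto a$ and $\begin{pmatrix}a&m\\ n&b\end{pmatrix}\mapsto b$. For an $R$-algebra $G$ with $[x,y]=xy-yx$, a sequence $(D_k)_{k\ge 0}$ of $R$-linear maps $G\to G$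 with $D_0=\mathrm{id}$ is a higher derivation if $D_k(xy)=\sum_{i+j=k}D_i(x)D_j(y)$ for all $k\ge0$ and $x,y\in G$. A sequence $(L_k)_{k\ge0}$ of $R$-linear maps $G\to G$ with $L_0=\mathrm{id}$ is a Lie higher derivation if $L_k([x,y])=\sum_{i+j=k}[L_i(x),L_j(y)]$ for all $k\ge0$ and $x,y\in G$. A Lie higher derivation $(L_k)$ is proper if there are a higher derivation $(D_k)$ and $R$-linear maps $\tau_k:G\to Z(G)$ ($k\ge1$) with $\tau_k([x,y])=0$ for all $x,y\in G$ and $L_k=D_k+\tau_k$ for all $k\ge1$. The algebra $G$ has the LHD property if every Lie higher derivation on $G$ is proper. **Theorem.** Suppose that $\mathcal G$ is weakly faithful, that is, for $a\in A$, $aM=\{0\}=Na$ implies $a=0$, and for $b\in B$, $Mb=\{0\}=bN$ implies $b=0$. If 1. $\pi_A(Z(\mathcal G))=Z(A)$ and $\pi_B(Z(\mathcal G))=Z(B)$, and 2. at least one of the algebras $A$, $B$ contains no nonzero central ideal (a nonzero two-sided ideal contained in the centre of that algebra), then $\mathcal G$ has the LHD property. -/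

import Mathlib

open MulOpposite Finset

/-! ### Higher derivations and Lie higher derivations of an algebra -/

section LieHigherDerivation

variable (R : Type*) [CommRing R] {G : Type*} [Ring G] [Algebra R G]

/-- A sequence `(D k)` of `R`-linear maps with `D 0 = id` and
`D k (x y) = ∑_{i+j=k} D i x * D j y` for all `k`. -/
def IsHigherDerivation (D : ℕ → G →ₗ[R] G) : Prop :=
  D 0 = LinearMap.id ∧
    ∀ (k : ℕ) (x y : G), D k (x * y) = ∑ p ∈ antidiagonal k, D p.1 x * D p.2 y

/-- A sequence `(L k)` of `R`-linear maps with `L 0 = id` and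
`L k [x, y] = ∑_{i+j=k} [L i x, L j y]` for all `k`, where `[x, y] = x y - y x`. -/
def IsLieHigherDerivation (L : ℕ → G →ₗ[R] G) : Prop :=
  L 0 = LinearMap.id ∧
    ∀ (k : ℕ) (x y : G), L k ⁅x, y⁆ = ∑ p ∈ antidiagonal k, ⁅L p.1 x, L p.2 y⁆

/-- `L` is proper: in every degree `k ≥ 1`, `L k = D k + τ k` where `D` is a higher derivation
and each `τ k` is an `R`-linear map into the centre which vanishes at commutators. (In degree `0`
both `L` and `D` are the identity; `τ 0` plays no role.) -/
def IsProperLieHigherDerivation (L : ℕ → G →ₗ[R] G) : Prop :=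
  IsLieHigherDerivation R L ∧
    ∃ D τ : ℕ → G →ₗ[R] G, IsHigherDerivation R D ∧
      ∀ k : ℕ, 1 ≤ k →
        (∀ x : G, τ k x ∈ Set.center G) ∧ (∀ x y : G, τ k ⁅x, y⁆ = 0) ∧ L k = D k + τ k

variable (G) in
/-- The LHD property: every Lie higher derivation is proper. -/
def HasLHDProperty : Prop :=
  ∀ L : ℕ → G →ₗ[R] G, IsLieHigherDerivation R L → IsProperLieHigherDerivation R L

end LieHigherDerivation

/-- The only two-sided ideal of `A` that is contained in the centre of `A` is zero. -/
def NoNonzeroCentralIdeal (A : Type*) [Ring A] : Prop :=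
  ∀ I : TwoSidedIdeal A, (∀ x ∈ I, x ∈ Set.center A) → I = ⊥

/-- `M` is `2`-torsion free. -/
def TwoTorsionFree (M : Type*) [AddCommGroup M] : Prop :=
  ∀ m : M, 2 • m = 0 → m = 0

/-! ### Morita contexts and generalized matrix algebras

Right modules are left modules over the opposite ring, so `op b • m` is `m b` and `op a • n`
is `n a`. -/

/-- A Morita context `(A, B, M, N, Φ, Ψ)` of `R`-algebras. The bimodule homomorphisms
`Φ : M ⊗_B N → A` and `Ψ : N ⊗_A M → B` are given by the corresponding balanced bilinear maps
`(m, n) ↦ m n` and `(n, m) ↦ n m`; the last two fields are the two commutative diagrams. -/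
structure MoritaContext (R A B M N : Type*) [CommRing R] [Ring A] [Algebra R A] [Ring B]
    [Algebra R B] [AddCommGroup M] [Module R M] [Module A M] [Module Bᵐᵒᵖ M]
    [SMulCommClass A Bᵐᵒᵖ M] [IsScalarTower R A M] [IsScalarTower R Bᵐᵒᵖ M]
    [AddCommGroup N] [Module R N] [Module B N] [Module Aᵐᵒᵖ N]
    [SMulCommClass B Aᵐᵒᵖ N] [IsScalarTower R B N] [IsScalarTower R Aᵐᵒᵖ N] where
  /-- `(m, n) ↦ m n ∈ A` -/
  Φ : M →ₗ[R] N →ₗ[R] A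
  /-- `(n, m) ↦ n m ∈ B` -/
  Ψ : N →ₗ[R] M →ₗ[R] B
  Φ_balanced : ∀ (m : M) (b : B) (n : N), Φ (op b • m) n = Φ m (b • n)
  Φ_smul_left : ∀ (a : A) (m : M) (n : N), Φ (a • m) n = a * Φ m n
  Φ_smul_right : ∀ (m : M) (n : N) (a : A), Φ m (op a • n) = Φ m n * a
  Ψ_balanced : ∀ (n : N) (a : A) (m : M), Ψ (op a • n) m = Ψ n (a • m)
  Ψ_smul_left : ∀ (b : B) (n : N) (m : M), Ψ (b • n) m = b * Ψ n m
  Ψ_smul_right : ∀ (n : N) (m : M) (b : B), Ψ n (op b • m) = Ψ n m * b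
  Φ_smul_eq : ∀ (m : M) (n : N) (m' : M), Φ m n • m' = op (Ψ n m') • m
  Ψ_smul_eq : ∀ (n : N) (m : M) (n' : N), Ψ n m • n' = op (Φ m n') • n

section GMA

variable {R A B M N : Type*} [CommRing R] [Ring A] [Algebra R A] [Ring B]
  [Algebra R B] [AddCommGroup M] [Module R M] [Module A M] [Module Bᵐᵒᵖ M]
  [SMulCommClass A Bᵐᵒᵖ M] [IsScalarTower R A M] [IsScalarTower R Bᵐᵒᵖ M]
  [AddCommGroup N] [Module R N] [Module B N] [Module Aᵐᵒᵖ N]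
  [SMulCommClass B Aᵐᵒᵖ N] [IsScalarTower R B N] [IsScalarTower R Aᵐᵒᵖ N]

/-- The generalized matrix algebra of a Morita context: the matrices with rows `(a, m)` and
`(n, b)`. -/
@[ext]
structure GenMatAlg (C : MoritaContext R A B M N) where
  a : A
  m : M
  n : N
  b : B

namespace GenMatAlg

variable {C : MoritaContext R A B M N}

instance : Zero (GenMatAlg C) := ⟨⟨0, 0, 0, 0⟩⟩
instance : One (GenMatAlg C) := ⟨⟨1, 0, 0, 1⟩⟩
instance : Add (GenMatAlg C) := ⟨fun x y => ⟨x.a + y.a, x.m + y.m, x.n + y.n, x.b + y.b⟩⟩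
instance : Neg (GenMatAlg C) := ⟨fun x => ⟨-x.a, -x.m, -x.n, -x.b⟩⟩
instance : SMul R (GenMatAlg C) := ⟨fun r x => ⟨r • x.a, r • x.m, r • x.n, r • x.b⟩⟩

/-- The usual multiplication of `2 × 2` matrices. -/
instance : Mul (GenMatAlg C) :=
  ⟨fun x y =>
    ⟨x.a * y.a + C.Φ x.m y.n, x.a • y.m + op y.b • x.m,
      op y.a • x.n + x.b • y.n, C.Ψ x.n y.m + x.b * y.b⟩⟩

@[simp] theorem zero_a : (0 : GenMatAlg C).a = 0 := rfl
@[simp] theorem zero_m : (0 : GenMatAlg C).m = 0 := rfl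
@[simp] theorem zero_n : (0 : GenMatAlg C).n = 0 := rfl
@[simp] theorem zero_b : (0 : GenMatAlg C).b = 0 := rfl
@[simp] theorem one_a : (1 : GenMatAlg C).a = 1 := rfl
@[simp] theorem one_m : (1 : GenMatAlg C).m = 0 := rfl
@[simp] theorem one_n : (1 : GenMatAlg C).n = 0 := rfl
@[simp] theorem one_b : (1 : GenMatAlg C).b = 1 := rfl
@[simp] theorem add_a (x y : GenMatAlg C) : (x + y).a = x.a + y.a := rfl
@[simp] theorem add_m (x y : GenMatAlg C) : (x + y).m = x.m + y.m := rfl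
@[simp] theorem add_n (x y : GenMatAlg C) : (x + y).n = x.n + y.n := rfl
@[simp] theorem add_b (x y : GenMatAlg C) : (x + y).b = x.b + y.b := rfl
@[simp] theorem neg_a (x : GenMatAlg C) : (-x).a = -x.a := rfl
@[simp] theorem neg_m (x : GenMatAlg C) : (-x).m = -x.m := rfl
@[simp] theorem neg_n (x : GenMatAlg C) : (-x).n = -x.n := rfl
@[simp] theorem neg_b (x : GenMatAlg C) : (-x).b = -x.b := rfl
@[simp] theorem smul_a (r : R) (x : GenMatAlg C) : (r • x).a = r • x.a := rfl
@[simp] theorem smul_m (r : R) (x : GenMatAlg C) : (r • x).m = r • x.m := rfl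
@[simp] theorem smul_n (r : R) (x : GenMatAlg C) : (r • x).n = r • x.n := rfl
@[simp] theorem smul_b (r : R) (x : GenMatAlg C) : (r • x).b = r • x.b := rfl
@[simp] theorem mul_a (x y : GenMatAlg C) : (x * y).a = x.a * y.a + C.Φ x.m y.n := rfl
@[simp] theorem mul_m (x y : GenMatAlg C) : (x * y).m = x.a • y.m + op y.b • x.m := rfl
@[simp] theorem mul_n (x y : GenMatAlg C) : (x * y).n = op y.a • x.n + x.b • y.n := rfl
@[simp] theorem mul_b (x y : GenMatAlg C) : (x * y).b = C.Ψ x.n y.m + x.b * y.b := rfl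

instance : AddCommGroup (GenMatAlg C) where
  add_assoc x y z := by ext <;> simp [add_assoc]
  zero_add x := by ext <;> simp
  add_zero x := by ext <;> simp
  nsmul := nsmulRec
  zsmul := zsmulRec
  neg_add_cancel x := by ext <;> simp
  add_comm x y := by ext <;> simp [add_comm]

instance : Ring (GenMatAlg C) where
  __ := (inferInstance : AddCommGroup (GenMatAlg C))
  mul_assoc x y z := by
    ext
    · simp [add_mul, mul_add, mul_assoc, C.Φ_smul_left, C.Φ_smul_right, C.Φ_balanced]
      abel
    · simp [add_smul, smul_add, mul_smul, C.Φ_smul_eq, smul_comm x.a]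
      abel
    · simp [add_smul, smul_add, mul_smul, C.Ψ_smul_eq, smul_comm x.b]
      abel
    · simp [add_mul, mul_add, mul_assoc, C.Ψ_smul_left, C.Ψ_smul_right, C.Ψ_balanced]
      abel
  left_distrib x y z := by
    ext <;> simp [mul_add, add_smul] <;> abel
  right_distrib x y z := by
    ext <;> simp [add_mul, add_smul] <;> abel
  zero_mul x := by ext <;> simp
  mul_zero x := by ext <;> simp
  one_mul x := by ext <;> simp
  mul_one x := by ext <;> simp

instance : Module R (GenMatAlg C) where
  one_smul x := by ext <;> simp
  mul_smul r s x := by ext <;> simp [mul_smul]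
  smul_zero r := by ext <;> simp
  smul_add r x y := by ext <;> simp
  add_smul r s x := by ext <;> simp [add_smul]
  zero_smul x := by ext <;> simp

instance : Algebra R (GenMatAlg C) :=
  Algebra.ofModule
    (fun r x y => by
      ext <;> simp [smul_algebra_smul_comm])
    (fun r x y => by
      ext <;> simp [smul_algebra_smul_comm])

variable (C) in
/-- `π_A`, the projection to the upper left corner. -/
def piA : GenMatAlg C →ₗ[R] A where
  toFun x := x.a
  map_add' _ _ := rfl
  map_smul' _ _ := rfl

variable (C) in
/-- `π_B`, the projection to the lower right corner. -/
def piB : GenMatAlg C →ₗ[R] B where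
  toFun x := x.b
  map_add' _ _ := rfl
  map_smul' _ _ := rfl

end GenMatAlg

end GMA

/-- Weak faithfulness of the generalized matrix algebra with entries in `A, M, N, B`:
`a M = 0 = N a` implies `a = 0`, and `M b = 0 = b N` implies `b = 0`. -/
def WeaklyFaithful (A B M N : Type*) [Ring A] [Ring B] [AddCommGroup M] [Module A M]
    [Module Bᵐᵒᵖ M] [AddCommGroup N] [Module B N] [Module Aᵐᵒᵖ N] : Prop :=
  (∀ a : A, (∀ m : M, a • m = 0) → (∀ n : N, op a • n = 0) → a = 0) ∧
    ∀ b : B, (∀ m : M, op b • m = 0) → (∀ n : N, b • n = 0) → b = 0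

/-! A Lie higher derivation is the same thing as an `R`-linear Lie homomorphism `L : G → G⟦X⟧`
lifting the identity, and a higher derivation is a multiplicative such map. So the claim becomes:
`L` is a homomorphism plus a central map. All degrees are treated at once, with `X`-adic
approximation in place of induction on `k`.

Let `e`, `f` be the diagonal idempotents. The series `L e` lifts `e`, and conjugation by some `u ≡
1` makes it commute with `e` (`exists_conj_commute`). Bracketing with `L e` is then a small
perturbation of bracketing with `e`, whose eigenvalues are `1`, `0`, `-1`. Since `G` is `2`-torsion
free, `L` preserves both off-diagonal corners and the diagonal. The stray `f`-part of `L (e x e)`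
commutes with the `f`-part of `L (f G f)`, so its coefficients are central in `f G f` and lift to
the centre of `G` by the centre hypothesis. Subtracting this part, and its mirror image, leaves a
map `D` that respects the Peirce corners (`exists_isPeirceSplit`).

A bracket with only one nonzero product, landing off the diagonal, shows that `D` is multiplicative
there. Faithfulness carries this to products inside a diagonal corner. For `e G f · f G e`, the
leading coefficients of the defect form a central ideal of `e G e`, hence vanish. The opposite
product then has a central defect with zero `e`-corner, which is zero as well. -/

section PowerSeriesLemmas

/-! ### `X`-adic tools over a noncommutative coefficient ring -/

open scoped PowerSeries

namespace PowerSeries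

variable {G : Type*} [Ring G]

theorem X_pow_add_dvd_mul {j k : ℕ} {p q : G⟦X⟧} (hp : X ^ j ∣ p) (hq : X ^ k ∣ q) :
    X ^ (j + k) ∣ p * q := by
  obtain ⟨p, rfl⟩ := hp
  obtain ⟨q, rfl⟩ := hq
  refine ⟨p * q, ?_⟩
  rw [pow_add, mul_assoc, ← mul_assoc p, (commute_X_pow p k).eq]
  simp only [mul_assoc]

theorem X_pow_dvd_mul_left {k : ℕ} (p : G⟦X⟧) {q : G⟦X⟧} (hq : X ^ k ∣ q) : X ^ k ∣ p * q := by
  simpa using X_pow_add_dvd_mul (j := 0) (p := p) (by simp) hq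

theorem X_pow_succ_dvd_mul_left {k : ℕ} {p q : G⟦X⟧} (hp : X ∣ p) (hq : X ^ k ∣ q) :
    X ^ (k + 1) ∣ p * q := by
  rw [add_comm]
  exact X_pow_add_dvd_mul (by simpa using hp) hq

theorem X_pow_succ_dvd_mul_right {k : ℕ} {p q : G⟦X⟧} (hp : X ^ k ∣ p) (hq : X ∣ q) :
    X ^ (k + 1) ∣ p * q :=
  X_pow_add_dvd_mul hp (by simpa using hq)

theorem X_dvd_mul_left (p : G⟦X⟧) {q : G⟦X⟧} (hq : X ∣ q) : X ∣ p * q := by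
  simpa using X_pow_dvd_mul_left (k := 1) p (by simpa using hq)

/-- Over a `2`-torsion free ring, `p` vanishes if divisibility of `p` by `X ^ k` always implies
divisibility of `2 • p` by `X ^ (k + 1)`. -/
theorem eq_zero_of_X_pow_dvd_two_smul (h2 : TwoTorsionFree G) {p : G⟦X⟧}
    (h : ∀ k, X ^ k ∣ p → X ^ (k + 1) ∣ 2 • p) : p = 0 := by
  have key : ∀ k, X ^ k ∣ p := by
    intro k
    induction k with
    | zero => simp
    | succ k ih =>
      rw [X_pow_dvd_iff]
      intro i hi
      apply h2
      rw [← map_nsmul]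
      exact X_pow_dvd_iff.1 (h k ih) i hi
  ext k
  simpa using X_pow_dvd_iff.1 (key (k + 1)) k (Nat.lt_succ_self k)

/-- An `X`-adically contracting map has a fixed point. -/
theorem exists_fixedPoint (F : G⟦X⟧ → G⟦X⟧)
    (hF : ∀ k x y, X ^ k ∣ x - y → X ^ (k + 1) ∣ F x - F y) : ∃ x, F x = x := by
  have h1 : ∀ k, X ^ k ∣ F^[k + 1] 0 - F^[k] 0 := by
    intro k
    induction k with
    | zero => simp
    | succ k ih =>
      rw [Function.iterate_succ_apply' F (k + 1), Function.iterate_succ_apply' F k]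
      exact hF k _ _ (by simpa only [Function.iterate_succ_apply'] using ih)
  have h2 : ∀ i j k, i < j → coeff i (F^[j + k] 0) = coeff i (F^[j] 0) := by
    intro i j k hij
    induction k with
    | zero => rfl
    | succ k ih =>
      have := X_pow_dvd_iff.1 (h1 (j + k)) i (by omega)
      rw [map_sub, sub_eq_zero] at this
      rw [← ih, ← this]
      rfl
  -- Coefficient `k` of the iterates is stable from the `(k + 1)`-st on.
  refine ⟨mk fun k => coeff k (F^[k + 1] 0), ?_⟩
  ext k
  have h3 : X ^ (k + 1) ∣ (mk fun k => coeff k (F^[k + 1] 0)) - F^[k + 1] 0 := by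
    rw [X_pow_dvd_iff]
    intro i hi
    obtain ⟨d, rfl⟩ := Nat.exists_eq_add_of_le (Nat.lt_succ_iff.1 hi)
    have := h2 i (i + 1) d (Nat.lt_succ_self i)
    rw [map_sub, coeff_mk, sub_eq_zero, ← this, add_right_comm]
  have h4 := X_pow_dvd_iff.1 (hF _ _ _ h3) k (by omega)
  rw [map_sub, sub_eq_zero] at h4
  rw [h4, coeff_mk, ← Function.iterate_succ_apply' F (k + 1)]
  exact h2 k (k + 1) 1 (Nat.lt_succ_self k)

/-- One-sided inverses are fixed points of `v ↦ 1 - x v` and `v ↦ 1 - v x`, which contract because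
`X ∣ x`; they coincide by associativity. -/
theorem exists_inverse_one_add {x : G⟦X⟧} (hx : X ∣ x) :
    ∃ v, (1 + x) * v = 1 ∧ v * (1 + x) = 1 := by
  obtain ⟨v, hv⟩ := exists_fixedPoint (fun v => 1 - x * v) fun k y z h => by
    rw [show (1 - x * y) - (1 - x * z) = -(x * (y - z)) by noncomm_ring]
    exact (X_pow_succ_dvd_mul_left hx h).neg_right
  obtain ⟨w, hw⟩ := exists_fixedPoint (fun v => 1 - v * x) fun k y z h => by
    rw [show (1 - y * x) - (1 - z * x) = -((y - z) * x) by noncomm_ring]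
    exact (X_pow_succ_dvd_mul_right h hx).neg_right
  have hv' : (1 + x) * v = 1 := by
    nth_rw 1 [add_mul, one_mul, ← hv]
    exact sub_add_cancel _ _
  have hw' : w * (1 + x) = 1 := by
    nth_rw 1 [mul_add, mul_one, ← hw]
    exact sub_add_cancel _ _
  have : w = v := by rw [← mul_one w, ← hv', ← mul_assoc, hw', one_mul]
  exact ⟨v, hv', this ▸ hw'⟩

theorem mem_center_iff_coeff {z : G⟦X⟧} :
    z ∈ Set.center G⟦X⟧ ↔ ∀ k, coeff k z ∈ Set.center G := by
  simp only [Semigroup.mem_center_iff]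
  constructor
  · intro h k g
    simpa using congrArg (coeff k) (h (C g))
  · intro h q
    ext k
    rw [coeff_mul, coeff_mul, ← Finset.Nat.sum_antidiagonal_swap]
    exact Finset.sum_congr rfl fun p _ => h _ _

/-- If `z` commutes with power series lifting the elements of `T`, with coefficients in `T`, then
the coefficients of `z` commute with `T`. -/
theorem coeff_commute_of_commute_lift {T : Set G} {ψ : G → G⟦X⟧} {z : G⟦X⟧}
    (h0 : ∀ b ∈ T, constantCoeff (ψ b) = b) (hT : ∀ b ∈ T, ∀ j, coeff j (ψ b) ∈ T)
    (hz : ∀ b ∈ T, z * ψ b = ψ b * z) (k : ℕ) :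
    ∀ b ∈ T, coeff k z * b = b * coeff k z := by
  induction k using Nat.strong_induction_on with
  | _ k ih =>
    intro b hb
    have h := congrArg (coeff k) (hz b hb)
    rw [coeff_mul, coeff_mul, ← Finset.Nat.sum_antidiagonal_swap (n := k)
      (f := fun p => coeff p.1 (ψ b) * coeff p.2 z)] at h
    -- The terms other than `(k, 0)` involve lower coefficients of `z` and elements of `T`, so they
    -- cancel by induction.
    have hk : (k, 0) ∈ antidiagonal k := by simp
    rw [← Finset.add_sum_erase _ _ hk, ← Finset.add_sum_erase _ _ hk] at h
    have hs : ∑ p ∈ (antidiagonal k).erase (k, 0), coeff p.1 z * coeff p.2 (ψ b) =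
        ∑ p ∈ (antidiagonal k).erase (k, 0), coeff p.swap.1 (ψ b) * coeff p.swap.2 z := by
      refine Finset.sum_congr rfl fun p hp => ?_
      obtain ⟨hne, hp⟩ := Finset.mem_erase.1 hp
      rw [HasAntidiagonal.mem_antidiagonal] at hp
      refine ih p.1 ?_ _ (hT b hb p.2)
      rcases Nat.lt_or_ge p.1 k with h | h
      · exact h
      · exact absurd (Prod.ext (by simp; omega) (by simp; omega)) hne
    rw [hs] at h
    simpa [h0 b hb] using add_right_cancel h

end PowerSeries

end PowerSeriesLemmas

/-! ### Peirce decompositions -/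

/-- A pair of complementary orthogonal idempotents. -/
structure IsPeircePair {S : Type*} [Ring S] (e f : S) : Prop where
  ee : e * e = e
  ff : f * f = f
  ef : e * f = 0
  fe : f * e = 0
  add : e + f = 1

namespace IsPeircePair

variable {S : Type*} [Ring S] {e f : S}

theorem symm (h : IsPeircePair e f) : IsPeircePair f e :=
  ⟨h.ff, h.ee, h.fe, h.ef, by rw [add_comm, h.add]⟩

theorem map {T : Type*} [Ring T] (h : IsPeircePair e f) (φ : S →+* T) :
    IsPeircePair (φ e) (φ f) := by
  constructor <;> simp [← map_mul, ← map_add, h.ee, h.ff, h.ef, h.fe, h.add]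

theorem eq_one_sub (h : IsPeircePair e f) : f = 1 - e := by rw [← h.add]; abel

theorem eq_sum (h : IsPeircePair e f) (x : S) :
    x = e * x * e + e * x * f + f * x * e + f * x * f := by
  calc x = (e + f) * x * (e + f) := by rw [h.add]; simp
    _ = _ := by noncomm_ring

theorem eq_of_corners (h : IsPeircePair e f) {x y : S} (h1 : e * x * e = e * y * e)
    (h2 : e * x * f = e * y * f) (h3 : f * x * e = f * y * e) (h4 : f * x * f = f * y * f) :
    x = y := by
  rw [h.eq_sum x, h.eq_sum y, h1, h2, h3, h4]

theorem ee' (h : IsPeircePair e f) (x : S) : e * (e * x) = e * x := by rw [← mul_assoc, h.ee]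
theorem ff' (h : IsPeircePair e f) (x : S) : f * (f * x) = f * x := by rw [← mul_assoc, h.ff]
theorem ef' (h : IsPeircePair e f) (x : S) : e * (f * x) = 0 := by rw [← mul_assoc, h.ef, zero_mul]
theorem fe' (h : IsPeircePair e f) (x : S) : f * (e * x) = 0 := by rw [← mul_assoc, h.fe, zero_mul]

theorem commute_right (h : IsPeircePair e f) {x : S} (hx : e * x = x * e) : f * x = x * f := by
  rw [h.eq_one_sub, sub_mul, mul_sub, hx, one_mul, mul_one]

end IsPeircePair

/-! ### Conjugating a lift of an idempotent into the diagonal -/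

section Diagonalization

open PowerSeries

variable {G : Type*} [Ring G] {e f : G}

/-- A power series lifting `e` is conjugate to one that commutes with `e`. -/
theorem IsPeircePair.exists_conj_commute (h : IsPeircePair e f) {P : PowerSeries G}
    (hP : constantCoeff P = e) :
    ∃ u v : PowerSeries G, u * v = 1 ∧ v * u = 1 ∧ constantCoeff u = 1 ∧
      C e * (u * P * v) = (u * P * v) * C e := by
  have H := h.map (C : G →+* PowerSeries G)
  set E : PowerSeries G := C e
  set F : PowerSeries G := C f
  set Q := E * P * E + F * P * F - E with hQ
  set O := E * P * F + F * P * E with hO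
  have hXQ : X ∣ Q := by
    rw [X_dvd_iff]; simp [hQ, E, F, hP, h.ee, h.fe]
  have hXO : X ∣ O := by
    rw [X_dvd_iff]; simp [hO, E, F, hP, h.ee, h.ef, h.fe]
  have hEQ : E * Q = Q * E := by
    simp only [hQ, mul_add, add_mul, mul_sub, sub_mul, mul_assoc, H.ee, H.ee', H.ef', H.fe, mul_zero]
  have hEO : E * O = O * F := by
    simp only [hO, mul_add, add_mul, mul_assoc, H.ee', H.ff, H.ef, H.ef', mul_zero]
  have hFO : F * O = O * E := by
    simp only [hO, mul_add, add_mul, mul_assoc, H.ee, H.ff', H.fe, H.fe', mul_zero]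
  have hPs : P = E + Q + O := by
    rw [hQ, hO]; nth_rw 1 [H.eq_sum P]; abel
  have hFQ : F * Q = Q * F := H.commute_right hEQ
  clear_value Q O
  -- Here `P = E + Q + O` with `Q` diagonal and `O` off-diagonal, both divisible by `X`. For
  -- off-diagonal `x`, the series `E + Q + x O` is diagonal, and `(1 + x) P = (E + Q + x O) (1 + x)`
  -- amounts to `x E - E x = r x`. On off-diagonal elements `x ↦ x E - E x` is its own inverse,
  -- which turns the equation into the fixed-point problem below.
  let r : PowerSeries G → PowerSeries G := fun x => x * O * x - O - x * Q + Q * x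
  obtain ⟨x, hx⟩ := exists_fixedPoint (fun x => F * r x * E - E * r x * F) fun k x y hxy => by
    have hr : X ^ (k + 1) ∣ r x - r y := by
      rw [show r x - r y = (x - y) * (O * x) + y * (O * (x - y)) - (x - y) * Q + Q * (x - y) by
        simp only [r]; noncomm_ring]
      refine dvd_add (dvd_sub (dvd_add ?_ ?_) ?_) ?_
      · exact X_pow_succ_dvd_mul_right hxy (hXO.mul_right x)
      · exact X_pow_dvd_mul_left _ (X_pow_succ_dvd_mul_left hXO hxy)
      · exact X_pow_succ_dvd_mul_right hxy hXQ
      · exact X_pow_succ_dvd_mul_left hXQ hxy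
    rw [show F * r x * E - E * r x * F - (F * r y * E - E * r y * F) =
      F * ((r x - r y) * E) - E * ((r x - r y) * F) by noncomm_ring]
    exact dvd_sub (X_pow_dvd_mul_left _ (hr.mul_right _)) (X_pow_dvd_mul_left _ (hr.mul_right _))
  have hEx : E * x = x * F := by
    rw [← hx]
    simp only [mul_sub, sub_mul, mul_assoc, H.ee', H.ff, H.ef, H.ef', mul_zero]
  have hFx : F * x = x * E := by
    rw [← hx]
    simp only [mul_sub, sub_mul, mul_assoc, H.ee, H.ff', H.fe, H.fe', mul_zero]
  have hEr : E * r x = r x * F := by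
    simp only [r, mul_add, mul_sub, add_mul, sub_mul]
    rw [← mul_assoc E (x * O), ← mul_assoc E x O, hEx, mul_assoc x F O, hFO, ← mul_assoc E x Q, hEx,
      ← mul_assoc E Q x, hEQ, hEO]
    simp only [mul_assoc, hEx, hFQ]
  have hxr : x * E - E * x = r x := by
    have hFr : F * r x = r x * E := by
      have h1 : F = 1 - E := H.eq_one_sub
      rw [h1, sub_mul, one_mul, hEr, h1, mul_sub, mul_one, sub_sub_cancel]
    have h2 : x = r x * E - r x * F := by
      nth_rw 1 [← hx]
      simp only [hFr, hEr, mul_assoc, H.ee, H.ff]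
    rw [h2, mul_sub, ← mul_assoc, ← mul_assoc, hEr, sub_mul]
    simp only [mul_assoc, H.ee, H.fe, H.ff, mul_zero, sub_zero, zero_sub, sub_neg_eq_add]
    rw [← h2, ← mul_add, H.add, mul_one]
  have hXx : X ∣ x := by
    have hr : X ∣ r x :=
      dvd_add (dvd_sub (dvd_sub ((X_dvd_mul_left _ hXO).mul_right _) hXO) (X_dvd_mul_left _ hXQ))
        (hXQ.mul_right _)
    rw [← hx]
    exact dvd_sub ((X_dvd_mul_left _ hr).mul_right _) ((X_dvd_mul_left _ hr).mul_right _)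
  obtain ⟨v, huv, hvu⟩ := exists_inverse_one_add hXx
  refine ⟨1 + x, v, huv, hvu, by simpa using X_dvd_iff.1 hXx, ?_⟩
  have hT : (1 + x) * P = (E + Q + x * O) * (1 + x) := by
    have h3 : x * E = E * x + (x * O * x - O - x * Q + Q * x) := by
      rw [← sub_eq_iff_eq_add', hxr]
    rw [hPs]
    simp only [add_mul, mul_add, one_mul, mul_one, h3]
    abel
  rw [hT, mul_assoc, huv, mul_one, mul_add, mul_add, add_mul, add_mul, hEQ, ← mul_assoc, hEx,
    mul_assoc x, hFO, mul_assoc]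

end Diagonalization

/-! ### Corner conditions, and Lie lifts of the identity to power series -/

section Peirce

open PowerSeries

variable {R G : Type*} [CommRing R] [Ring G] [Algebra R G] {e f : G}

/-- The corner `e G e` acts faithfully on the off-diagonal corners, and its central elements are
the `e`-corners of central elements of `G`. -/
structure IsCenterLiftingCorner (e f : G) : Prop where
  faithful : ∀ x, e * x * e = x → (∀ y, x * (e * y * f) = 0) → (∀ y, f * y * e * x = 0) → x = 0
  lift : ∀ z, e * z * e = z → (∀ y, z * (e * y * e) = e * y * e * z) →
    ∃ c ∈ Set.center G, e * c = z

/-- The corner `e G e` contains no nonzero central ideal. -/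
def NoCentralIdealCorner (e : G) : Prop :=
  ∀ T : Set G, (∀ s ∈ T, e * s * e = s ∧ ∀ y, s * (e * y * e) = e * y * e * s) →
    (∀ s ∈ T, ∀ y, e * y * e * s ∈ T) → ∀ s ∈ T, s = 0

namespace PowerSeries

theorem coeff_mul_of_forall_lt {k : ℕ} {x : PowerSeries G} (hx : ∀ i < k, coeff i x = 0)
    (y : PowerSeries G) : coeff k (x * y) = coeff k x * constantCoeff y := by
  rw [coeff_mul, Finset.sum_eq_single (k, 0)]
  · simp
  · intro p hp hne
    rw [HasAntidiagonal.mem_antidiagonal] at hp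
    rw [hx p.1, zero_mul]
    rcases Nat.lt_or_ge p.1 k with h | h
    · exact h
    · exact absurd (Prod.ext (by simp; omega) (by simp; omega)) hne
  · simp

theorem coeff_mul_of_forall_lt' {k : ℕ} {x : PowerSeries G} (hx : ∀ i < k, coeff i x = 0)
    (y : PowerSeries G) : coeff k (y * x) = constantCoeff y * coeff k x := by
  rw [coeff_mul, Finset.sum_eq_single (0, k)]
  · simp
  · intro p hp hne
    rw [HasAntidiagonal.mem_antidiagonal] at hp
    rw [hx p.2, mul_zero]
    rcases Nat.lt_or_ge p.2 k with h | h
    · exact h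
    · exact absurd (Prod.ext (by simp; omega) (by simp; omega)) hne
  · simp

end PowerSeries

/-- Such a `c` lies in `e G e`, and being central it can be moved next to `f`, so it annihilates
both off-diagonal corners. Hence a central element is determined by its `f`-corner. -/
theorem IsCenterLiftingCorner.eq_zero_of_mem_center (h : IsPeircePair e f)
    (He : IsCenterLiftingCorner e f) {c : G} (hc : c ∈ Set.center G) (hfc : f * c = 0) : c = 0 := by
  rw [Semigroup.mem_center_iff] at hc
  have hec : e * c = c := by
    have : (e + f) * c = c := by rw [h.add, one_mul]
    rwa [add_mul, hfc, add_zero] at this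
  apply He.faithful
  · rw [hec, ← hc, hec]
  · intro y; rw [← hc, mul_assoc, hfc, mul_zero]
  · intro y; rw [mul_assoc, hec, mul_assoc, hc, ← mul_assoc, hfc, zero_mul]

theorem IsCenterLiftingCorner.powerSeries_eq_zero_of_mem_center (h : IsPeircePair e f)
    (He : IsCenterLiftingCorner e f) {c : PowerSeries G} (hc : c ∈ Set.center (PowerSeries G))
    (hfc : C f * c = 0) : c = 0 := by
  ext k
  refine He.eq_zero_of_mem_center h (mem_center_iff_coeff.1 hc k) ?_
  rw [← coeff_C_mul, hfc, map_zero]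

/-- Faithfulness of the corner passes to power series. -/
theorem IsCenterLiftingCorner.powerSeries_eq_zero (He : IsCenterLiftingCorner e f)
    {D : G → PowerSeries G} (hD : ∀ x, constantCoeff (D x) = x) {x : PowerSeries G}
    (hx : C e * x * C e = x) (h1 : ∀ y, x * D (e * y * f) = 0) (h2 : ∀ y, D (f * y * e) * x = 0) :
    x = 0 := by
  ext k
  rw [map_zero]
  induction k using Nat.strong_induction_on with
  | _ k ih =>
    apply He.faithful
    · simpa using congrArg (coeff k) hx
    · intro y
      have := coeff_mul_of_forall_lt ih (D (e * y * f))
      rw [h1, hD] at this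
      simpa using this.symm
    · intro y
      have := coeff_mul_of_forall_lt' ih (D (f * y * e))
      rw [h2, hD] at this
      simpa using this.symm

/-! ### The Peirce components of a Lie homomorphism -/

/-- Bracketing with `Q` raises the `X`-adic order, so `c` is divisible by every power of `X`. -/
theorem eq_zero_of_two_smul_eq_commutator (h2 : TwoTorsionFree G) {Q c : PowerSeries G}
    (hQ : X ∣ Q) (r : ℤ) (h : 2 • c = r • (Q * c - c * Q)) : c = 0 := by
  refine eq_zero_of_X_pow_dvd_two_smul h2 fun k hk => ?_
  rw [h, zsmul_eq_mul]
  exact X_pow_dvd_mul_left _ (dvd_sub (X_pow_succ_dvd_mul_left hQ hk)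
    (X_pow_succ_dvd_mul_right hk hQ))

theorem corner_commutator {S : Type*} [Ring S] {E P g h y : S} (hg : g * P = P * g)
    (hh : h * P = P * h) :
    g * (P * y - y * P) * h = (E * (g * y * h) - g * y * h * E) +
      ((P - E) * (g * y * h) - g * y * h * (P - E)) := by
  calc g * (P * y - y * P) * h = (g * P) * y * h - g * y * (P * h) := by noncomm_ring
    _ = (P * g) * y * h - g * y * (h * P) := by rw [hg, hh]
    _ = _ := by noncomm_ring

section Commutator

variable (h : IsPeircePair e f) (h2 : TwoTorsionFree G) {P y : PowerSeries G}
  (hP : constantCoeff P = e) (hEP : C e * P = P * C e)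

include h h2 hP hEP

/-- Write `P = e + Q` with `X ∣ Q`. Bracketing with `e` gives `0` on the diagonal corners and `-1`
on `f G⟦X⟧ e`, so a component `c` there satisfies `c = [Q, c]` or `2 c = [Q, c]` and vanishes. -/
theorem IsPeircePair.eq_offDiag_of_commutator (hy : P * y - y * P = y) :
    C e * y * C f = y := by
  have H := h.map (C : G →+* PowerSeries G)
  have hFP := H.commute_right hEP
  have hQ : X ∣ P - C e := by rw [X_dvd_iff]; simp [hP]
  have h1 : C e * y * C e = 0 := by
    have := corner_commutator (E := C e) (y := y) hEP hEP
    refine eq_zero_of_two_smul_eq_commutator h2 hQ 2 ?_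
    rw [hy] at this
    nth_rw 1 [this]
    simp only [mul_assoc, H.ee, H.ee']
    noncomm_ring
  have h3 : C f * y * C f = 0 := by
    have := corner_commutator (E := C e) (y := y) hFP hFP
    refine eq_zero_of_two_smul_eq_commutator h2 hQ 2 ?_
    rw [hy] at this
    nth_rw 1 [this]
    simp only [mul_assoc, H.fe, H.ef', mul_zero]
    noncomm_ring
  have h4 : C f * y * C e = 0 := by
    have := corner_commutator (E := C e) (y := y) hFP hEP
    refine eq_zero_of_two_smul_eq_commutator h2 hQ 1 ?_
    rw [hy] at this
    rw [one_smul, two_nsmul]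
    nth_rw 1 [this]
    simp only [mul_assoc, H.ee, H.ef']
    noncomm_ring
  conv_rhs => rw [H.eq_sum y, h1, h3, h4]
  simp

/-- The same perturbation argument for eigenvalue `0`: an off-diagonal component satisfies `± c +
[Q, c] = 0`, hence vanishes. -/
theorem IsPeircePair.commute_of_commutator (hy : P * y - y * P = 0) :
    C e * y = y * C e := by
  have H := h.map (C : G →+* PowerSeries G)
  have hFP := H.commute_right hEP
  have hQ : X ∣ P - C e := by rw [X_dvd_iff]; simp [hP]
  have h3 : C e * y * C f = 0 := by
    have := corner_commutator (E := C e) (y := y) hEP hFP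
    refine eq_zero_of_two_smul_eq_commutator h2 hQ (-2) ?_
    rw [hy, mul_zero, zero_mul] at this
    rw [← neg_eq_iff_add_eq_zero.2 this.symm]
    simp only [mul_assoc, H.ee', H.fe, mul_zero]
    noncomm_ring
  have h4 : C f * y * C e = 0 := by
    have := corner_commutator (E := C e) (y := y) hFP hEP
    refine eq_zero_of_two_smul_eq_commutator h2 hQ 2 ?_
    rw [hy, mul_zero, zero_mul] at this
    rw [← neg_eq_iff_add_eq_zero.2 this.symm]
    simp only [mul_assoc, H.ee, H.ef']
    noncomm_ring
  rw [H.eq_one_sub, mul_sub, mul_one, sub_eq_zero] at h3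
  rw [H.eq_one_sub, sub_mul, one_mul, sub_mul, sub_eq_zero] at h4
  rw [h3, h4]

end Commutator

/-- An `R`-linear Lie homomorphism `G → G⟦X⟧` lifting the identity: the generating series of a Lie
higher derivation. -/
structure IsLieLift (L : G →ₗ[R] PowerSeries G) : Prop where
  const : ∀ x, constantCoeff (L x) = x
  lie : ∀ x y, L (x * y - y * x) = L x * L y - L y * L x

namespace IsLieLift

variable {L : G →ₗ[R] PowerSeries G}

/-- `L 1` commutes with every `L b` because `[1, b] = 0`, and `L b` lifts `b`. -/
theorem map_one_mem_center (hL : IsLieLift L) : L 1 ∈ Set.center (PowerSeries G) := by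
  rw [mem_center_iff_coeff]
  intro k
  rw [Semigroup.mem_center_iff]
  intro g
  refine (coeff_commute_of_commute_lift (T := Set.univ) (ψ := L) (fun b _ => hL.const b)
    (fun _ _ _ => Set.mem_univ _) (fun b _ => ?_) k g (Set.mem_univ _)).symm
  rw [← sub_eq_zero, ← hL.lie]
  simp

theorem commute_symm (hL : IsLieLift L) (h : IsPeircePair e f) (hE : C e * L e = L e * C e) :
    C f * L f = L f * C f := by
  have H := h.map (C : G →+* PowerSeries G)
  have h1 := Semigroup.mem_center_iff.1 hL.map_one_mem_center
  rw [show L f = L 1 - L e by rw [h.eq_one_sub, map_sub], mul_sub, sub_mul, h1,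
    H.commute_right hE]

theorem map_offDiag (hL : IsLieLift L) (h : IsPeircePair e f) (h2 : TwoTorsionFree G)
    (hE : C e * L e = L e * C e) (x : G) :
    C e * L (e * x * f) * C f = L (e * x * f) := by
  refine h.eq_offDiag_of_commutator h2 (hL.const e) hE ?_
  rw [← hL.lie]
  simp [mul_assoc, h.ee', h.fe]

theorem map_diag (hL : IsLieLift L) (h : IsPeircePair e f) (h2 : TwoTorsionFree G)
    (hE : C e * L e = L e * C e) {x : G} (hx : e * x = x * e) :
    C e * L x = L x * C e := by
  refine h.commute_of_commutator h2 (hL.const e) hE ?_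
  rw [← hL.lie, hx, sub_self, map_zero]

/-- The part of `L` on the corner `e G e` that falls outside this corner, lifted to the centre. -/
theorem exists_central_part (hL : IsLieLift L) (h : IsPeircePair e f) (h2 : TwoTorsionFree G)
    (hE : C e * L e = L e * C e) (He : IsCenterLiftingCorner e f)
    (Hf : IsCenterLiftingCorner f e) :
    ∃ τ : G →ₗ[R] PowerSeries G, (∀ x, τ x ∈ Set.center (PowerSeries G)) ∧
      (∀ x, constantCoeff (τ x) = 0) ∧ (∀ x, e * x * e = 0 → τ x = 0) ∧
      ∀ x, C e * (L (e * x * e) - τ (e * x * e)) * C e = L (e * x * e) - τ (e * x * e) := by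
  have H := h.map (C : G →+* PowerSeries G)
  have hd : ∀ x, C f * L (e * x * e) = L (e * x * e) * C f := fun x =>
    H.commute_right (hL.map_diag h h2 hE (by simp only [mul_assoc, h.ee, h.ee']))
  have hd' : ∀ x, C f * L (f * x * f) = L (f * x * f) * C f := fun x =>
    H.commute_right (hL.map_diag h h2 hE (by simp only [mul_assoc, h.fe, h.ef', mul_zero]))
  have hex : ∀ x, ∃ c ∈ Set.center (PowerSeries G), C f * c = C f * L (e * x * e) := by
    intro x
    -- Since `[e x e, f b f] = 0`, the `f`-parts of the two images commute; the second lifts `f b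
    -- f`, so each coefficient of the first is central in `f G f`.
    have hz : ∀ k, ∃ c ∈ Set.center G, f * c = coeff k (C f * L (e * x * e)) := by
      intro k
      apply Hf.lift
      · rw [← coeff_C_mul, ← coeff_mul_C]
        rw [mul_assoc, mul_assoc, ← hd, H.ff', H.ff']
      · intro y
        refine coeff_commute_of_commute_lift (T := {b | f * b * f = b})
          (ψ := fun b => C f * L (f * b * f)) ?_ ?_ ?_ k (f * y * f) ?_
        · intro b hb
          simp only [Set.mem_ofPred_eq] at hb
          simp only [map_mul, hL.const, constantCoeff_C]
          simp only [mul_assoc, h.ff']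
          rw [← mul_assoc, hb]
        · intro b hb j
          simp only [Set.mem_ofPred_eq]
          rw [← coeff_C_mul, ← coeff_mul_C]
          simp only [mul_assoc f b f]
          simp only [← mul_assoc f b f]
          rw [mul_assoc, mul_assoc, ← hd', H.ff', H.ff']
        · intro b hb
          have hc : L (e * x * e) * L (f * b * f) = L (f * b * f) * L (e * x * e) := by
            rw [← sub_eq_zero, ← hL.lie]
            simp [mul_assoc, h.ef', h.fe']
          exact ((Commute.refl (C f)).mul_right (hd' b)).mul_left
            (Commute.mul_right (hd x).symm hc)
        · simp only [Set.mem_ofPred_eq, mul_assoc, h.ff, h.ff']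
    choose c hc hfc using hz
    refine ⟨PowerSeries.mk c, mem_center_iff_coeff.2 fun k => by simpa using hc k, ?_⟩
    ext k
    simpa using hfc k
  have huniq : ∀ {c d : PowerSeries G}, c ∈ Set.center (PowerSeries G) →
      d ∈ Set.center (PowerSeries G) → C f * c = C f * d → c = d := by
    intro c d hc hd hcd
    rw [← sub_eq_zero]
    refine He.powerSeries_eq_zero_of_mem_center h ?_ (by rw [mul_sub, hcd, sub_self])
    rw [sub_eq_add_neg]
    exact Set.add_mem_center hc (Set.neg_mem_center hd)
  -- Uniqueness of the central lift makes this choice linear.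
  choose t ht hft using hex
  let τ : G →ₗ[R] PowerSeries G :=
    { toFun := t
      map_add' := fun x y => huniq (ht _) (Set.add_mem_center (ht x) (ht y)) (by
        rw [mul_add, hft, hft, hft, ← mul_add, ← map_add, mul_add, add_mul])
      map_smul' := fun r x => huniq (ht _) (by
          rw [Semigroup.mem_center_iff]
          intro g
          have := Semigroup.mem_center_iff.1 (ht x) g
          simp only [RingHom.id_apply, mul_smul_comm, smul_mul_assoc, this]) (by
        rw [RingHom.id_apply, mul_smul_comm, hft, hft, ← mul_smul_comm, ← map_smul,
          mul_smul_comm, smul_mul_assoc]) }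
  refine ⟨τ, ht, fun x => ?_, fun x hx => ?_, fun x => ?_⟩
  · refine He.eq_zero_of_mem_center h ?_ ?_
    · change constantCoeff (t x) ∈ _
      simpa using mem_center_iff_coeff.1 (ht x) 0
    · have := congrArg constantCoeff (hft x)
      simp only [map_mul, constantCoeff_C, hL.const] at this
      rwa [mul_assoc e, h.fe'] at this
  · refine He.powerSeries_eq_zero_of_mem_center h (ht x) ?_
    change C f * t x = 0
    rw [hft, hx, map_zero, mul_zero]
  · set d := L (e * x * e) - τ (e * x * e) with hd1
    have h1 : C f * d = 0 := by
      rw [hd1, mul_sub, sub_eq_zero]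
      refine Eq.trans ?_ (hft _).symm
      simp only [mul_assoc, h.ee, h.ee']
    have h3 : d * C f = 0 := by
      rw [← h1, hd1, mul_sub, sub_mul, hd]
      congr 1
      exact (Semigroup.mem_center_iff.1 (ht _) _).symm
    have h4 : (C e + C f) * d * (C e + C f) = d := by rw [H.add, one_mul, mul_one]
    rwa [add_mul, h1, add_zero, mul_add, mul_assoc _ _ (C f), h3, mul_zero, add_zero] at h4

end IsLieLift

/-! ### Multiplicativity -/

/-- `D + τ` is a Lie homomorphism lifting the identity, where `D` respects the Peirce decomposition
and `τ` is central and vanishes off the diagonal. -/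
structure IsPeirceSplit (e f : G) (D τ : G →ₗ[R] PowerSeries G) : Prop where
  const : ∀ x, constantCoeff (D x) = x
  map_e_mul : ∀ x, D (e * x) = C e * D x
  map_mul_e : ∀ x, D (x * e) = D x * C e
  map_f_mul : ∀ x, D (f * x) = C f * D x
  map_mul_f : ∀ x, D (x * f) = D x * C f
  central : ∀ x, τ x ∈ Set.center (PowerSeries G)
  central_ef : ∀ x, τ (e * x * f) = 0
  central_fe : ∀ x, τ (f * x * e) = 0
  lie : ∀ x y, D (x * y - y * x) + τ (x * y - y * x) = D x * D y - D y * D x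

namespace IsPeirceSplit

variable {D τ : G →ₗ[R] PowerSeries G}

theorem symm (hD : IsPeirceSplit e f D τ) : IsPeirceSplit f e D τ :=
  ⟨hD.const, hD.map_f_mul, hD.map_mul_f, hD.map_e_mul, hD.map_mul_e, hD.central, hD.central_fe,
    hD.central_ef, hD.lie⟩

/-- The bracket of `x` and `y` is `x y`, which lies in `e G f` where `τ` vanishes, and `D y * D x =
0`. This covers both `e G e · e G f` and `e G f · f G f`. -/
theorem map_mul_of_ef (h : IsPeircePair e f) (hD : IsPeirceSplit e f D τ) {x y : G}
    (hx : e * x = x) (hy : y * f = y) (hyx : y * x = 0) : D (x * y) = D x * D y := by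
  have H := h.map (C : G →+* PowerSeries G)
  have h1 := hD.lie x y
  have h3 : τ (x * y) = 0 := by
    rw [← hD.central_ef (x * y)]
    congr 1
    rw [mul_assoc, mul_assoc, hy, ← mul_assoc, hx]
  have h4 : D y * D x = 0 := by
    rw [← hy, ← hx, hD.map_mul_f, hD.map_e_mul, mul_assoc, H.fe', mul_zero]
  rwa [hyx, sub_zero, h3, h4, add_zero, sub_zero] at h1

/-- For `m` in `e G f`, both `D (x y) D m` and `D x D y D m` equal `D (x y m)`; similarly on the
left for `f G e`. The defect is therefore killed by faithfulness. -/
theorem map_mul_corner (h : IsPeircePair e f) (hD : IsPeirceSplit e f D τ)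
    (He : IsCenterLiftingCorner e f) {x y : G} (hx : e * x * e = x) (hy : e * y * e = y) :
    D (x * y) = D x * D y := by
  have ex : e * x = x := by rw [← hx]; simp only [mul_assoc, h.ee']
  have xe : x * e = x := by rw [← hx]; simp only [mul_assoc, h.ee]
  have ey : e * y = y := by rw [← hy]; simp only [mul_assoc, h.ee']
  have ye : y * e = y := by rw [← hy]; simp only [mul_assoc, h.ee]
  have fx : f * x = 0 := by rw [← ex, h.fe']
  have fy : f * y = 0 := by rw [← ey, h.fe']
  have xf : x * f = 0 := by rw [← xe, mul_assoc, h.ef, mul_zero]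
  have yf : y * f = 0 := by rw [← ye, mul_assoc, h.ef, mul_zero]
  rw [← sub_eq_zero]
  refine He.powerSeries_eq_zero hD.const ?_ (fun m => ?_) (fun n => ?_)
  · rw [mul_sub, sub_mul, ← hD.map_e_mul, ← hD.map_mul_e, ← mul_assoc (C e), ← hD.map_e_mul,
      mul_assoc (D _) (D _), ← hD.map_mul_e, ex, ye, ← mul_assoc e, ex, mul_assoc x, ye]
  · have h1 : ∀ {a m}, e * a = a → f * a = 0 → m * f = m → D (a * m) = D a * D m :=
      fun ha ha' hm => hD.map_mul_of_ef h ha hm (by rw [← hm, mul_assoc, ha', mul_zero])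
    have hm : e * m * f * f = e * m * f := by rw [mul_assoc, h.ff]
    generalize e * m * f = m at hm
    rw [sub_mul, mul_assoc, ← h1 ey fy hm, ← h1 ex fx (by rw [mul_assoc, hm]),
      ← h1 (by rw [← mul_assoc, ex]) (by rw [← mul_assoc, fx, zero_mul]) hm, mul_assoc, sub_self]
  · have h1 : ∀ {a n}, a * e = a → a * f = 0 → f * n = n → D (n * a) = D n * D a :=
      fun ha ha' hn => hD.symm.map_mul_of_ef h.symm hn ha (by rw [← hn, ← mul_assoc, ha', zero_mul])
    have hn : f * (f * n * e) = f * n * e := by rw [mul_assoc, h.ff']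
    generalize f * n * e = n at hn
    rw [mul_sub, ← mul_assoc, ← h1 xe xf hn, ← h1 ye yf (by rw [← mul_assoc, hn]),
      ← h1 (by rw [mul_assoc, ye]) (by rw [mul_assoc, yf, mul_zero]) hn, mul_assoc, sub_self]

/-- By the Lie identity this difference of defects is `-τ [m, n]`. -/
theorem corner_defect_sub_mem_center (hD : IsPeirceSplit e f D τ) (m n : G) :
    (D (m * n) - D m * D n) - (D (n * m) - D n * D m) ∈ Set.center (PowerSeries G) := by
  have h1 := hD.lie m n
  have h3 : (D (m * n) - D m * D n) - (D (n * m) - D n * D m) = -τ (m * n - n * m) := by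
    rw [map_sub D, ← eq_sub_iff_add_eq] at h1
    rw [sub_sub_sub_comm, h1]
    abel
  rw [h3]
  exact Set.neg_mem_center (hD.central _)

/-- The defect of multiplicativity on `e G f × f G e` takes values in `e G⟦X⟧ e` and its leading
coefficients form a central ideal of `e G e`. -/
theorem map_mul_of_ef_fe (h : IsPeircePair e f) (hD : IsPeirceSplit e f D τ)
    (He : IsCenterLiftingCorner e f) (hI : NoCentralIdealCorner e) {m n : G} (hem : e * m = m) (hmf : m * f = m)
    (hfn : f * n = n) (hne : n * e = n) : D (m * n) = D m * D n := by
  have H := h.map (C : G →+* PowerSeries G)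
  suffices hk : ∀ k, ∀ m n, e * m = m → m * f = m → f * n = n → n * e = n →
      coeff k (D (m * n) - D m * D n) = 0 by
    rw [← sub_eq_zero]
    ext k
    exact hk k m n hem hmf hfn hne
  clear hem hmf hfn hne m n
  intro k
  induction k using Nat.strong_induction_on with
  | _ k ih =>
    intro m n hem hmf hfn hne
    refine hI {s | ∃ m n, e * m = m ∧ m * f = m ∧ f * n = n ∧ n * e = n ∧
      coeff k (D (m * n) - D m * D n) = s} ?_ ?_ _ ⟨m, n, hem, hmf, hfn, hne, rfl⟩
    · rintro _ ⟨m, n, hem, hmf, hfn, hne, rfl⟩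
      refine ⟨?_, fun y => ?_⟩
      · rw [← coeff_C_mul, ← coeff_mul_C]
        congr 1
        rw [mul_sub, sub_mul, ← hD.map_e_mul, ← hD.map_mul_e, ← mul_assoc (C e), ← hD.map_e_mul,
          mul_assoc (D _) (D _), ← hD.map_mul_e, ← mul_assoc e, hem, mul_assoc m, hne]
      · have hc := Semigroup.mem_center_iff.1
          (mem_center_iff_coeff.1 (hD.corner_defect_sub_mem_center m n) k) (e * y * e)
        -- The defect of `n m` lives in the `f`-corner, so commuting with `e y e` only concerns the
        -- defect of `m n`.
        have hw1 : C e * (D (n * m) - D n * D m) = 0 := by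
          rw [mul_sub, ← hD.map_e_mul, ← mul_assoc (C e), ← hD.map_e_mul, ← mul_assoc, ← hfn, h.ef',
            zero_mul, map_zero, zero_mul, sub_zero]
        have hw2 : (D (n * m) - D n * D m) * C e = 0 := by
          rw [sub_mul, ← hD.map_mul_e, mul_assoc (D _), ← hD.map_mul_e, mul_assoc, ← hmf, mul_assoc,
            h.fe, mul_zero, mul_zero, map_zero, mul_zero, sub_zero]
        have hw3 : e * y * e * coeff k (D (n * m) - D n * D m) = 0 := by
          rw [mul_assoc, ← coeff_C_mul, hw1, map_zero, mul_zero]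
        have hw4 : coeff k (D (n * m) - D n * D m) * (e * y * e) = 0 := by
          rw [mul_assoc e, ← mul_assoc, ← coeff_mul_C, hw2, map_zero, zero_mul]
        rw [map_sub (coeff k) (D (m * n) - D m * D n), mul_sub, sub_mul, hw3, hw4, sub_zero,
          sub_zero] at hc
        exact hc.symm
    · rintro _ ⟨m, n, hem, hmf, hfn, hne, rfl⟩ y
      -- Replacing `m` by `e y e m` multiplies the defect by `D (e y e)`; as lower coefficients
      -- vanish by induction, coefficient `k` is multiplied by `e y e`.
      refine ⟨e * y * e * m, n, ?_, ?_, hfn, hne, ?_⟩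
      · simp only [mul_assoc, h.ee']
      · rw [mul_assoc, hmf]
      have hfx : f * (e * y * e) = 0 := by rw [mul_assoc, h.fe']
      have hex : e * (e * y * e) = e * y * e := by simp only [mul_assoc, h.ee']
      have h1 : D (e * y * e * m) = D (e * y * e) * D m :=
        hD.map_mul_of_ef h hex hmf (by rw [← hmf, mul_assoc, hfx, mul_zero])
      have h3 : D (e * y * e * (m * n)) = D (e * y * e) * D (m * n) :=
        hD.map_mul_corner h He (by simp only [mul_assoc, h.ee, h.ee'])
          (by rw [← mul_assoc, hem, mul_assoc, hne])
      rw [mul_assoc (e * y * e), h1, h3, mul_assoc (D _), ← mul_sub,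
        coeff_mul_of_forall_lt' (fun i hi => ih i hi m n hem hmf hfn hne), hD.const]

/-- The other defect is already zero, so this one is central; its `e`-corner vanishes, and
faithfulness of the `f`-corner finishes. -/
theorem map_mul_of_fe_ef (h : IsPeircePair e f) (hD : IsPeirceSplit e f D τ)
    (He : IsCenterLiftingCorner e f) (Hf : IsCenterLiftingCorner f e)
    (hI : NoCentralIdealCorner e) {m n : G} (hem : e * m = m) (hmf : m * f = m)
    (hfn : f * n = n) (hne : n * e = n) : D (n * m) = D n * D m := by
  have hc := hD.corner_defect_sub_mem_center m n
  rw [hD.map_mul_of_ef_fe h He hI hem hmf hfn hne, sub_self, zero_sub] at hc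
  have hc' := Set.neg_mem_center hc
  rw [neg_neg] at hc'
  rw [← sub_eq_zero]
  refine Hf.powerSeries_eq_zero_of_mem_center h.symm hc' ?_
  rw [mul_sub, ← hD.map_e_mul, ← mul_assoc (C e), ← hD.map_e_mul, ← mul_assoc, ← hfn, h.ef',
    zero_mul, map_zero, zero_mul, sub_zero]

theorem _root_.IsPeircePair.corner_mul {S : Type*} [Ring S] {e f : S} (h : IsPeircePair e f)
    (g k x y : S) : g * (x * y) * k = g * x * e * (e * y * k) + g * x * f * (f * y * k) := by
  simp only [mul_assoc, h.ee', h.ff']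
  rw [← mul_add, ← mul_add, ← add_mul, h.add, one_mul]

theorem corner_map_mul_ee (h : IsPeircePair e f) (hD : IsPeirceSplit e f D τ)
    (He : IsCenterLiftingCorner e f)
    (hef : ∀ {m n}, e * m = m → m * f = m → f * n = n → n * e = n → D (m * n) = D m * D n)
    (x y : G) : C e * D (x * y) * C e = C e * (D x * D y) * C e := by
  have H := h.map (C : G →+* PowerSeries G)
  rw [H.corner_mul (C e) (C e)]
  simp only [← hD.map_e_mul, ← hD.map_mul_e, ← hD.map_f_mul, ← hD.map_mul_f]
  rw [h.corner_mul, map_add, hD.map_mul_corner h He (x := e * x * e) (y := e * y * e),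
    hef (m := e * x * f) (n := f * y * e)] <;>
    simp only [mul_assoc, h.ee, h.ee', h.ff, h.ff']

theorem corner_map_mul_ef (h : IsPeircePair e f) (hD : IsPeirceSplit e f D τ) (x y : G) :
    C e * D (x * y) * C f = C e * (D x * D y) * C f := by
  have H := h.map (C : G →+* PowerSeries G)
  rw [H.corner_mul (C e) (C f)]
  simp only [← hD.map_e_mul, ← hD.map_mul_e, ← hD.map_f_mul, ← hD.map_mul_f]
  rw [h.corner_mul, map_add, hD.map_mul_of_ef h (x := e * x * e) (y := e * y * f),
    hD.map_mul_of_ef h (x := e * x * f) (y := f * y * f)] <;>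
    simp only [mul_assoc, h.ee', h.ff, h.fe', mul_zero]

theorem map_mul (h : IsPeircePair e f) (hD : IsPeirceSplit e f D τ)
    (He : IsCenterLiftingCorner e f) (Hf : IsCenterLiftingCorner f e)
    (hI : NoCentralIdealCorner e) (x y : G) : D (x * y) = D x * D y := by
  refine (h.map (C : G →+* PowerSeries G)).eq_of_corners ?_ (hD.corner_map_mul_ef h x y)
    (hD.symm.corner_map_mul_ef h.symm x y) ?_
  · exact hD.corner_map_mul_ee h He (hD.map_mul_of_ef_fe h He hI) x y
  · exact hD.symm.corner_map_mul_ee h.symm Hf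
      (fun h1 h2 h3 h4 => hD.map_mul_of_fe_ef h He Hf hI h3 h4 h1 h2) x y

end IsPeirceSplit

/-! ### Removing the central part and returning to sequences of maps -/

theorem commutator_add_central {S : Type*} [Ring S] (a b : S) {s t : S} (hs : s ∈ Set.center S)
    (ht : t ∈ Set.center S) : (a + s) * (b + t) - (b + t) * (a + s) = a * b - b * a := by
  rw [Semigroup.mem_center_iff] at hs ht
  rw [add_mul, mul_add, mul_add, add_mul, mul_add, mul_add, ← hs b, ← ht a, ht s]
  abel

theorem IsPeircePair.map_mul_of_corners (h : IsPeircePair e f) {D : G →ₗ[R] PowerSeries G}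
    (hee : ∀ x, C e * D (e * x * e) * C e = D (e * x * e))
    (hef : ∀ x, C e * D (e * x * f) * C f = D (e * x * f))
    (hfe : ∀ x, C f * D (f * x * e) * C e = D (f * x * e))
    (hff : ∀ x, C f * D (f * x * f) * C f = D (f * x * f)) (x : G) :
    D (e * x) = C e * D x ∧ D (x * e) = D x * C e := by
  have H := h.map (C : G →+* PowerSeries G)
  have h1 : e * x = e * x * e + e * x * f := by rw [← mul_add, h.add, mul_one]
  have h2 : x * e = e * x * e + f * x * e := by rw [← add_mul, ← add_mul, h.add, one_mul]
  have h3 : D x = D (e * x * e) + D (e * x * f) + D (f * x * e) + D (f * x * f) := by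
    nth_rw 1 [h.eq_sum x]; simp only [map_add]
  have h4 : D (e * x) = D (e * x * e) + D (e * x * f) := by rw [← map_add, ← h1]
  have h5 : D (x * e) = D (e * x * e) + D (f * x * e) := by rw [← map_add, ← h2]
  rw [h3, h4, h5, ← hee, ← hef, ← hfe, ← hff]
  constructor
  · simp only [mul_add, mul_assoc, H.ee', H.ef', add_zero]
  · simp only [add_mul, mul_assoc, H.ee, H.fe, mul_zero, add_zero]

namespace IsLieLift

variable {L : G →ₗ[R] PowerSeries G}

theorem exists_isPeirceSplit (hL : IsLieLift L) (h : IsPeircePair e f) (h2 : TwoTorsionFree G)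
    (hE : C e * L e = L e * C e) (He : IsCenterLiftingCorner e f)
    (Hf : IsCenterLiftingCorner f e) :
    ∃ D τ : G →ₗ[R] PowerSeries G, IsPeirceSplit e f D τ ∧ L = D + τ := by
  have hF := hL.commute_symm h hE
  obtain ⟨τ₁, c₁, k₁, z₁, d₁⟩ := hL.exists_central_part h h2 hE He Hf
  obtain ⟨τ₂, c₂, k₂, z₂, d₂⟩ := hL.exists_central_part h.symm h2 hF Hf He
  have hc : ∀ x, (τ₁ + τ₂) x ∈ Set.center (PowerSeries G) := fun x =>
    Set.add_mem_center (c₁ x) (c₂ x)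
  have hτee : ∀ x, τ₂ (e * x * e) = 0 := fun x => z₂ _ (by
    simp only [mul_assoc, h.fe', zero_mul])
  have hτff : ∀ x, τ₁ (f * x * f) = 0 := fun x => z₁ _ (by
    simp only [mul_assoc, h.ef', zero_mul])
  have hτef : ∀ x, (τ₁ + τ₂) (e * x * f) = 0 := fun x => by
    rw [LinearMap.add_apply, z₁ _ (by simp only [mul_assoc, h.fe, mul_zero]),
      z₂ _ (by simp only [mul_assoc, h.fe', zero_mul]), add_zero]
  have hτfe : ∀ x, (τ₁ + τ₂) (f * x * e) = 0 := fun x => by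
    rw [LinearMap.add_apply, z₁ _ (by simp only [mul_assoc, h.ef', zero_mul]),
      z₂ _ (by simp only [mul_assoc, h.ef, mul_zero]), add_zero]
  have hee : ∀ x, C e * (L - (τ₁ + τ₂)) (e * x * e) * C e = (L - (τ₁ + τ₂)) (e * x * e) := by
    intro x
    rw [LinearMap.sub_apply, LinearMap.add_apply, hτee, add_zero, d₁]
  have hff : ∀ x, C f * (L - (τ₁ + τ₂)) (f * x * f) * C f = (L - (τ₁ + τ₂)) (f * x * f) := by
    intro x
    rw [LinearMap.sub_apply, LinearMap.add_apply, hτff, zero_add, d₂]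
  have hef : ∀ x, C e * (L - (τ₁ + τ₂)) (e * x * f) * C f = (L - (τ₁ + τ₂)) (e * x * f) := by
    intro x
    rw [LinearMap.sub_apply, hτef, sub_zero, hL.map_offDiag h h2 hE]
  have hfe : ∀ x, C f * (L - (τ₁ + τ₂)) (f * x * e) * C e = (L - (τ₁ + τ₂)) (f * x * e) := by
    intro x
    rw [LinearMap.sub_apply, hτfe, sub_zero, hL.map_offDiag h.symm h2 hF]
  have hl := h.map_mul_of_corners hee hef hfe hff
  have hr := h.symm.map_mul_of_corners hff hfe hef hee
  refine ⟨L - (τ₁ + τ₂), τ₁ + τ₂, ⟨fun x => ?_, fun x => (hl x).1, fun x => (hl x).2,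
    fun x => (hr x).1, fun x => (hr x).2, hc, hτef, hτfe, fun x y => ?_⟩, by abel⟩
  · simp [hL.const, k₁, k₂]
  · rw [← commutator_add_central _ _ (hc x) (hc y)]
    simp only [LinearMap.sub_apply, sub_add_cancel, hL.lie]

/-- A Lie homomorphism `G → G⟦X⟧` lifting the identity is the sum of a ring homomorphism and a
central map. -/
theorem exists_eq_add_central (hL : IsLieLift L) (h : IsPeircePair e f) (h2 : TwoTorsionFree G)
    (He : IsCenterLiftingCorner e f) (Hf : IsCenterLiftingCorner f e)
    (hI : NoCentralIdealCorner e) :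
    ∃ D τ : G →ₗ[R] PowerSeries G, (∀ x, constantCoeff (D x) = x) ∧
      (∀ x y, D (x * y) = D x * D y) ∧ (∀ x, τ x ∈ Set.center (PowerSeries G)) ∧ L = D + τ := by
  obtain ⟨u, v, huv, hvu, hu, hE⟩ := h.exists_conj_commute (hL.const e)
  have hv : constantCoeff v = 1 := by
    have := congrArg constantCoeff huv
    rwa [_root_.map_mul, hu, one_mul, _root_.map_one] at this
  let conj (a b : PowerSeries G) : PowerSeries G →ₗ[R] PowerSeries G :=
    LinearMap.mulRight R b ∘ₗ LinearMap.mulLeft R a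
  have hconj : ∀ a b x, conj a b x = a * x * b := fun _ _ _ => rfl
  have hmul : ∀ {a b}, b * a = 1 → ∀ x y, conj a b (x * y) = conj a b x * conj a b y := by
    intro a b hba x y
    calc a * (x * y) * b = a * x * 1 * y * b := by noncomm_ring
      _ = a * x * (b * a) * y * b := by rw [hba]
      _ = a * x * b * (a * y * b) := by noncomm_ring
  clear_value conj
  have hL' : IsLieLift (conj u v ∘ₗ L) := by
    refine ⟨fun x => ?_, fun x y => ?_⟩
    · simp [hconj, hu, hv, hL.const]
    · rw [LinearMap.comp_apply, hL.lie, map_sub, hmul hvu, hmul hvu]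
      rfl
  obtain ⟨D, τ, hD, hLD⟩ := hL'.exists_isPeirceSplit h h2
    (by rw [LinearMap.comp_apply, hconj]; exact hE) He Hf
  -- Undoing the conjugation leaves `τ` unchanged, since its values are central.
  refine ⟨conj v u ∘ₗ D, τ, fun x => ?_, fun x y => ?_, hD.central, ?_⟩
  · simp [hconj, hu, hv, hD.const]
  · rw [LinearMap.comp_apply, hD.map_mul h He Hf hI, hmul huv]
    rfl
  · ext1 x
    have h1 := congrArg (conj v u) (LinearMap.congr_fun hLD x)
    rw [LinearMap.comp_apply, LinearMap.add_apply, map_add, hconj v u (τ x),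
      Semigroup.mem_center_iff.1 (hD.central x) v, mul_assoc, hvu, mul_one, hconj, hconj] at h1
    rw [LinearMap.add_apply, LinearMap.comp_apply, ← h1]
    calc L x = 1 * L x * 1 := by simp
      _ = (v * u) * L x * (v * u) := by rw [hvu]
      _ = _ := by noncomm_ring

end IsLieLift

/-- The LHD property for rings with a suitable Peirce decomposition. -/
theorem hasLHDProperty_of_peirce (h : IsPeircePair e f) (h2 : TwoTorsionFree G)
    (He : IsCenterLiftingCorner e f) (Hf : IsCenterLiftingCorner f e)
    (hI : NoCentralIdealCorner e) : HasLHDProperty R G := by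
  intro L hL
  refine ⟨hL, ?_⟩
  let Lt : G →ₗ[R] PowerSeries G :=
    { toFun := fun x => PowerSeries.mk fun k => L k x
      map_add' := fun x y => by ext; simp
      map_smul' := fun r x => by ext k; simp [PowerSeries.coeff]; rfl }
  have hLt : ∀ k x, coeff k (Lt x) = L k x := fun k x => coeff_mk k fun k => L k x
  have hLie : IsLieLift Lt := by
    refine ⟨fun x => ?_, fun x y => ?_⟩
    · rw [← coeff_zero_eq_constantCoeff_apply, hLt, hL.1, LinearMap.id_apply]
    · ext k
      rw [hLt, ← Ring.lie_def, hL.2, map_sub, coeff_mul, coeff_mul,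
        ← Finset.Nat.sum_antidiagonal_swap (n := k) (f := fun p => coeff p.1 (Lt y) * coeff p.2 (Lt x)),
        ← Finset.sum_sub_distrib]
      simp only [hLt, Ring.lie_def, Prod.fst_swap, Prod.snd_swap]
  obtain ⟨D, τ, hD0, hDm, hτ, hLD⟩ := hLie.exists_eq_add_central h h2 He Hf hI
  have hcoeff : ∀ (k : ℕ) (r : R) (p : PowerSeries G), coeff k (r • p) = r • coeff k p :=
    fun _ _ _ => rfl
  let co (k : ℕ) (T : G →ₗ[R] PowerSeries G) : G →ₗ[R] G :=
    { toFun := fun x => coeff k (T x)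
      map_add' := fun x y => by simp
      map_smul' := fun r x => by simp [hcoeff] }
  have hco : ∀ k T x, co k T x = coeff k (T x) := fun _ _ _ => rfl
  -- Central summands drop out of brackets, so `L` and the multiplicative map `D` agree on
  -- commutators.
  have hτlie : ∀ x y, τ (x * y - y * x) = 0 := by
    intro x y
    have h1 := hLie.lie x y
    rw [hLD] at h1
    simp only [LinearMap.add_apply] at h1
    rw [commutator_add_central _ _ (hτ x) (hτ y), map_sub D, hDm, hDm] at h1
    exact add_eq_left.1 h1
  refine ⟨fun k => co k D, fun k => co k τ, ⟨?_, fun k x y => ?_⟩, fun k _ =>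
    ⟨fun x => mem_center_iff_coeff.1 (hτ x) k, fun x y => ?_, ?_⟩⟩
  · ext x
    simp [hco, hD0]
  · simp only [hco, hDm, coeff_mul]
  · rw [Ring.lie_def, hco, hτlie, map_zero]
  · ext x
    rw [← hLt, hLD, LinearMap.add_apply, LinearMap.add_apply, map_add, hco, hco]

end Peirce

/-! ### Verifying the corner conditions for a generalized matrix algebra -/

section GMA

variable {R A B M N : Type*} [CommRing R] [Ring A] [Algebra R A] [Ring B]
  [Algebra R B] [AddCommGroup M] [Module R M] [Module A M] [Module Bᵐᵒᵖ M]
  [SMulCommClass A Bᵐᵒᵖ M] [IsScalarTower R A M] [IsScalarTower R Bᵐᵒᵖ M]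
  [AddCommGroup N] [Module R N] [Module B N] [Module Aᵐᵒᵖ N]
  [SMulCommClass B Aᵐᵒᵖ N] [IsScalarTower R B N] [IsScalarTower R Aᵐᵒᵖ N]

namespace GenMatAlg

variable (C : MoritaContext R A B M N)

/-- The diagonal idempotent of the corner `A`. -/
def idemA : GenMatAlg C := ⟨1, 0, 0, 0⟩

/-- The diagonal idempotent of the corner `B`. -/
def idemB : GenMatAlg C := ⟨0, 0, 0, 1⟩

theorem isPeircePair : IsPeircePair (idemA C) (idemB C) := by
  constructor <;> ext <;> simp [idemA, idemB]

variable {C}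

theorem idemA_mul_mul_idemA (x : GenMatAlg C) : idemA C * x * idemA C = ⟨x.a, 0, 0, 0⟩ := by
  ext <;> simp [idemA]

theorem idemB_mul_mul_idemB (x : GenMatAlg C) : idemB C * x * idemB C = ⟨0, 0, 0, x.b⟩ := by
  ext <;> simp [idemB]

theorem idemA_mul_mul_idemB (x : GenMatAlg C) : idemA C * x * idemB C = ⟨0, x.m, 0, 0⟩ := by
  ext <;> simp [idemA, idemB]

theorem idemB_mul_mul_idemA (x : GenMatAlg C) : idemB C * x * idemA C = ⟨0, 0, x.n, 0⟩ := by
  ext <;> simp [idemA, idemB]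

/-- If `2 a = 0`, then `a M` and `N a` consist of `2`-torsion, hence vanish, and weak faithfulness
gives `a = 0`; likewise for `b`. -/
theorem twoTorsionFree (hM : TwoTorsionFree M) (hN : TwoTorsionFree N)
    (hwf : WeaklyFaithful A B M N) : TwoTorsionFree (GenMatAlg C) := by
  intro x hx
  rw [two_nsmul] at hx
  have ha : x.a + x.a = 0 := congrArg GenMatAlg.a hx
  have hm : x.m + x.m = 0 := congrArg GenMatAlg.m hx
  have hn : x.n + x.n = 0 := congrArg GenMatAlg.n hx
  have hb : x.b + x.b = 0 := congrArg GenMatAlg.b hx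
  ext
  · refine hwf.1 _ (fun m => hM _ ?_) (fun n => hN _ ?_)
    · rw [two_nsmul, ← add_smul, ha, zero_smul]
    · rw [two_nsmul, ← add_smul, ← op_add, ha, op_zero, zero_smul]
  · exact hM _ (by rw [two_nsmul, hm])
  · exact hN _ (by rw [two_nsmul, hn])
  · refine hwf.2 _ (fun m => hM _ ?_) (fun n => hN _ ?_)
    · rw [two_nsmul, ← add_smul, ← op_add, hb, op_zero, zero_smul]
    · rw [two_nsmul, ← add_smul, hb, zero_smul]

theorem isCenterLiftingCorner_idemA (hwf : WeaklyFaithful A B M N)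
    (hA : piA C '' Set.center (GenMatAlg C) = Set.center A) :
    IsCenterLiftingCorner (idemA C) (idemB C) := by
  constructor
  · intro x hx h1 h2
    rw [idemA_mul_mul_idemA] at hx
    rw [← hx]
    have : x.a = 0 := by
      refine hwf.1 _ (fun m => ?_) (fun n => ?_)
      · simpa [idemA_mul_mul_idemB] using congrArg GenMatAlg.m (h1 ⟨0, m, 0, 0⟩)
      · simpa [idemB_mul_mul_idemA] using congrArg GenMatAlg.n (h2 ⟨0, 0, n, 0⟩)
    rw [this]
    rfl
  · intro z hz hc
    rw [idemA_mul_mul_idemA] at hz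
    have hza : z.a ∈ Set.center A := by
      rw [Semigroup.mem_center_iff]
      intro g
      have := congrArg GenMatAlg.a (hc ⟨g, 0, 0, 0⟩)
      rw [idemA_mul_mul_idemA, ← hz] at this
      simpa using this.symm
    rw [← hA] at hza
    obtain ⟨c, hcc, hca⟩ := hza
    refine ⟨c, hcc, ?_⟩
    have h1 := Semigroup.mem_center_iff.1 hcc (idemA C)
    have h2 := idemA_mul_mul_idemA c
    rw [mul_assoc, ← h1, (isPeircePair C).ee'] at h2
    rw [h2, ← hz, ← hca]
    rfl

theorem isCenterLiftingCorner_idemB (hwf : WeaklyFaithful A B M N)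
    (hB : piB C '' Set.center (GenMatAlg C) = Set.center B) :
    IsCenterLiftingCorner (idemB C) (idemA C) := by
  constructor
  · intro x hx h1 h2
    rw [idemB_mul_mul_idemB] at hx
    rw [← hx]
    have : x.b = 0 := by
      refine hwf.2 _ (fun m => ?_) (fun n => ?_)
      · simpa [idemA_mul_mul_idemB] using congrArg GenMatAlg.m (h2 ⟨0, m, 0, 0⟩)
      · simpa [idemB_mul_mul_idemA] using congrArg GenMatAlg.n (h1 ⟨0, 0, n, 0⟩)
    rw [this]
    rfl
  · intro z hz hc
    rw [idemB_mul_mul_idemB] at hz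
    have hzb : z.b ∈ Set.center B := by
      rw [Semigroup.mem_center_iff]
      intro g
      have := congrArg GenMatAlg.b (hc ⟨0, 0, 0, g⟩)
      rw [idemB_mul_mul_idemB, ← hz] at this
      simpa using this.symm
    rw [← hB] at hzb
    obtain ⟨c, hcc, hcb⟩ := hzb
    refine ⟨c, hcc, ?_⟩
    have h1 := Semigroup.mem_center_iff.1 hcc (idemB C)
    have h2 := idemB_mul_mul_idemB c
    rw [mul_assoc, ← h1, (isPeircePair C).ff'] at h2
    rw [h2, ← hz, ← hcb]
    rfl

end GenMatAlg

/-- A set of central elements which is stable under left multiplication consists of zero if there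
is no nonzero central ideal. -/
theorem NoNonzeroCentralIdeal.eq_zero_of_mem {A : Type*} [Ring A] (hA : NoNonzeroCentralIdeal A)
    {T : Set A} (hT : T ⊆ Set.center A) (hmul : ∀ s ∈ T, ∀ y, y * s ∈ T) {s : A} (hs : s ∈ T) :
    s = 0 := by
  have hc : ∀ x ∈ AddSubgroup.closure T, x ∈ Set.center A := fun x hx =>
    (AddSubgroup.closure_le (K := (Subring.center A).toAddSubgroup)).2 hT hx
  have hl : ∀ {x y}, y ∈ AddSubgroup.closure T → x * y ∈ AddSubgroup.closure T := by
    intro x y hy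
    induction hy using AddSubgroup.closure_induction with
    | mem y hy => exact AddSubgroup.subset_closure (hmul y hy x)
    | zero => rw [mul_zero]; exact zero_mem _
    | add y z _ _ hy hz => rw [mul_add]; exact add_mem hy hz
    | neg y _ hy => rw [mul_neg]; exact neg_mem hy
  -- Right absorption follows from left absorption because the closure is central.
  let I : TwoSidedIdeal A := TwoSidedIdeal.mk' (AddSubgroup.closure T : Set A) (zero_mem _)
    (fun hx hy => add_mem hx hy) (fun hx => neg_mem hx) hl
    (fun {x y} hx => by rw [← Semigroup.mem_center_iff.1 (hc x hx) y]; exact hl hx)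
  have hI : I = ⊥ := hA I fun x hx => hc x (by simpa [I] using hx)
  have hs' : s ∈ I := by
    simpa [I] using AddSubgroup.subset_closure hs
  rw [hI] at hs'
  exact hs'

namespace GenMatAlg

variable {C : MoritaContext R A B M N}

theorem noCentralIdealCorner_idemA (hA : NoNonzeroCentralIdeal A) :
    NoCentralIdealCorner (idemA C) := by
  intro T hT hmul s hs
  have h0 : s.a = 0 := by
    refine hA.eq_zero_of_mem (T := GenMatAlg.a '' T) ?_ ?_ ⟨s, hs, rfl⟩
    · rintro _ ⟨t, ht, rfl⟩
      rw [Semigroup.mem_center_iff]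
      intro g
      have := congrArg GenMatAlg.a ((hT t ht).2 ⟨g, 0, 0, 0⟩)
      rw [idemA_mul_mul_idemA] at this
      simpa using this.symm
    · rintro _ ⟨t, ht, rfl⟩ y
      refine ⟨_, hmul t ht ⟨y, 0, 0, 0⟩, ?_⟩
      rw [idemA_mul_mul_idemA]
      simp
  rw [← (hT s hs).1, idemA_mul_mul_idemA, h0]
  rfl

theorem noCentralIdealCorner_idemB (hB : NoNonzeroCentralIdeal B) :
    NoCentralIdealCorner (idemB C) := by
  intro T hT hmul s hs
  have h0 : s.b = 0 := by
    refine hB.eq_zero_of_mem (T := GenMatAlg.b '' T) ?_ ?_ ⟨s, hs, rfl⟩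
    · rintro _ ⟨t, ht, rfl⟩
      rw [Semigroup.mem_center_iff]
      intro g
      have := congrArg GenMatAlg.b ((hT t ht).2 ⟨0, 0, 0, g⟩)
      rw [idemB_mul_mul_idemB] at this
      simpa using this.symm
    · rintro _ ⟨t, ht, rfl⟩ y
      refine ⟨_, hmul t ht ⟨0, 0, 0, y⟩, ?_⟩
      rw [idemB_mul_mul_idemB]
      simp
  rw [← (hT s hs).1, idemB_mul_mul_idemB, h0]
  rfl

end GenMatAlg

end GMA

theorem mainTheorem6 {R A B M N : Type*} [CommRing R] [Ring A] [Algebra R A] [Ring B]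
    [Algebra R B] [AddCommGroup M] [Module R M] [Module A M] [Module Bᵐᵒᵖ M]
    [SMulCommClass A Bᵐᵒᵖ M] [IsScalarTower R A M] [IsScalarTower R Bᵐᵒᵖ M]
    [AddCommGroup N] [Module R N] [Module B N] [Module Aᵐᵒᵖ N]
    [SMulCommClass B Aᵐᵒᵖ N] [IsScalarTower R B N] [IsScalarTower R Aᵐᵒᵖ N]
    (C : MoritaContext R A B M N)
    (hMN : Nontrivial M ∨ Nontrivial N)
    (hM : TwoTorsionFree M) (hN : TwoTorsionFree N)
    (hwf : WeaklyFaithful A B M N)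
    (hA : GenMatAlg.piA C '' Set.center (GenMatAlg C) = Set.center A)
    (hB : GenMatAlg.piB C '' Set.center (GenMatAlg C) = Set.center B)
    (hideal : NoNonzeroCentralIdeal A ∨ NoNonzeroCentralIdeal B) :
    HasLHDProperty R (GenMatAlg C) := by
  have h2 := GenMatAlg.twoTorsionFree (C := C) hM hN hwf
  have HA := GenMatAlg.isCenterLiftingCorner_idemA hwf hA
  have HB := GenMatAlg.isCenterLiftingCorner_idemB hwf hB
  rcases hideal with h | h
  · exact hasLHDProperty_of_peirce (GenMatAlg.isPeircePair C) h2 HA HB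
      (GenMatAlg.noCentralIdealCorner_idemA h)
  -- The Peirce argument is symmetric in the idempotents, so `B` can play the role of `A`.
  · exact hasLHDProperty_of_peirce (GenMatAlg.isPeircePair C).symm h2 HB HA
      (GenMatAlg.noCentralIdealCorner_idemB h)
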